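/- **Setting.** Let $X_{\rm trn}\in\mathbb R^{N\times m}$, $Y_{\rm trn}\in\mathbb R^{N\times n}$, $X_{\rm val}\in\mathbb R^{N'\times m}$, $Y_{\rm val}\in\mathbb R^{N'\times n}$ with $m\ge\max\{N,N'\}$, let $h\ge\max\{m,n\}$, and let $X_{\rm trn},X_{\rm val}$ have full row rank. For $W_1\in\mathbb R^{m\times h}$, $W_2\in\mathbb R^{h\times n}$ put (Frobenius norm) $$L_{\rm trn}(W_1,W_2)=\tfrac12\|Y_{\rm trn}-X_{\rm trn}W_1W_2\|^2,\quad L_{\rm val}(W_1,W_2)=\tfrac12\|Y_{\rm val}-X_{\rm val}W_1W_2\|^2,\quad L_{\rm trn}^*(W_1)=\min_{W_2}L_{\rm trn}(W_1,W_2).$$ The bilevel problem is $\min_{W_1,\;W_2\in\mathcal S(W_1)}L_{\rm val}(W_1,W_2)$ with $\mathcal S(W_1)=\arg\min_{W_2}L_{\rm trn}(W_1,W_2)$. A pair $(W_1,W_2)$ is an $(\epsilon_1,\epsilon_2)$ solution of it if $L_{\rm trn}(W_1,W_2)-L^*_{\rm trn}(W_1)\le\epsilon_2$ and $L_{\rm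 val}(W_1,W_2)\le L_{\rm val}(W_1',W_2')+\epsilon_1$ for all $(W_1',W_2')$ with $L_{\rm trn}(W_1',W_2')-L^*_{\rm trn}(W_1')\le\epsilon_2$. For $\gamma>0$ let $L_\gamma=L_{\rm val}+\gamma(L_{\rm trn}-L_{\rm trn}^*)$; a pair is an $\epsilon$-solution of the penalized problem with parameter $\gamma$ if $L_\gamma(W_1,W_2)\le L_\gamma(W_1',W_2')+\epsilon$ for all $(W_1',W_2')$. **Assumption.** For all $\epsilon_1,\epsilon_2\ge0$ there is an $(\epsilon_1,\epsilon_2)$ solution $(W_1^*,W_2^*)$ of the bilevel problem with $L_{\rm trn}(W_1^*,W_2^*)-\min_{W_1,W_2}L_{\rm trn}(W_1,W_2)\le\epsilon_2$. **Theorem (Relations of global solutions).** Under this assumption: 1. For every $\kappa>0$ there is $C>0$, depending only on $\kappa$ and the problem data, such that for all $\epsilon_2>0$ and all $\gamma\ge\kappa\,\epsilon_2^{-1}$, every $\epsilon_2$-solution of the penalized problem with parameter $\gamma$ is an $(\epsilon_2,\epsilon_\gamma)$ solution of the bilevel problem for some $\epsilon_\gamma$ with $0\le\epsilon_\gamma\le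 C\epsilon_2^2$. 2. Conversely, there is $C>0$, depending only on the problem data, such that for every $\epsilon_1>0$ there is $\gamma^*$ with $0<\gamma^*\le C\epsilon_1^{-1}$ such that for every $\gamma>\gamma^*$, every global solution of the bilevel problem is an $\epsilon_1$-solution of the penalized problem with parameter $\gamma$. -/

import Mathlib

noncomputable section

namespace BilevelRep

section Abstract

variable {U V : Type*}

/-- The lower-level value function `g*(u) = min_v g(u,v)`, written as an infimum. For the
least-squares losses used below, `g` is nonnegative and `V` is nonempty, so the infimum is a
genuine one (and it is attained). -/
def valueFn (g : U → V → ℝ) (u : U) : ℝ := ⨅ v, g u v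

/-- The lower-level solution set `S(u) = argmin_v g(u,v)`. -/
def lowerSolutions (g : U → V → ℝ) (u : U) : Set V := {v | ∀ v', g u v ≤ g u v'}

/-- `(u,v)` is a global solution of `min_{u, v ∈ S(u)} f(u,v)`. -/
def IsGlobalBilevelSolution (f g : U → V → ℝ) (u : U) (v : V) : Prop :=
  v ∈ lowerSolutions g u ∧ ∀ u' v', v' ∈ lowerSolutions g u' → f u v ≤ f u' v'

/-- `(u,v)` is an `(ε₁, ε₂)` global solution of the bilevel problem: it is `ε₂`-feasible, and
its upper-level value is within `ε₁` of that of every `ε₂`-feasible point. -/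
def IsApproxBilevelSolution (f g : U → V → ℝ) (ε₁ ε₂ : ℝ) (u : U) (v : V) : Prop :=
  g u v - valueFn g u ≤ ε₂ ∧
    ∀ u' v', g u' v' - valueFn g u' ≤ ε₂ → f u v ≤ f u' v' + ε₁

/-- The penalized objective `L_γ(u,v) = f(u,v) + γ (g(u,v) - g*(u))`. -/
def penalized (f g : U → V → ℝ) (γ : ℝ) (u : U) (v : V) : ℝ :=
  f u v + γ * (g u v - valueFn g u)

/-- `(u,v)` is an `ε` global solution of the penalized problem with parameter `γ`. -/
def IsApproxPenalizedSolution (f g : U → V → ℝ) (γ ε : ℝ) (u : U) (v : V) : Prop :=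
  ∀ u' v', penalized f g γ u v ≤ penalized f g γ u' v' + ε

end Abstract

section Loss

attribute [local instance] Matrix.frobeniusNormedAddCommGroup

/-- Least-squares loss `½ ‖Y - X W₁ W₂‖²` (Frobenius norm) of a two-layer linear network. -/
def lsLoss {N m n h : ℕ} (X : Matrix (Fin N) (Fin m) ℝ) (Y : Matrix (Fin N) (Fin n) ℝ)
    (W₁ : Matrix (Fin m) (Fin h) ℝ) (W₂ : Matrix (Fin h) (Fin n) ℝ) : ℝ :=
  1 / 2 * ‖Y - X * W₁ * W₂‖ ^ 2

end Loss

/-- For all `ε₁, ε₂ ≥ 0` the bilevel representation learning problem with hidden width `h` has an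
`(ε₁, ε₂)` solution whose training loss is within `ε₂` of its minimum over both layers. -/
def SharedBackbone {N N' m n : ℕ} (h : ℕ)
    (Xtrn : Matrix (Fin N) (Fin m) ℝ) (Ytrn : Matrix (Fin N) (Fin n) ℝ)
    (Xval : Matrix (Fin N') (Fin m) ℝ) (Yval : Matrix (Fin N') (Fin n) ℝ) : Prop :=
  ∀ ε₁ ε₂ : ℝ, 0 ≤ ε₁ → 0 ≤ ε₂ →
    ∃ (W₁ : Matrix (Fin m) (Fin h) ℝ) (W₂ : Matrix (Fin h) (Fin n) ℝ),
      IsApproxBilevelSolution (lsLoss Xval Yval) (lsLoss Xtrn Ytrn) ε₁ ε₂ W₁ W₂ ∧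
      lsLoss Xtrn Ytrn W₁ W₂ -
        (⨅ W : Matrix (Fin m) (Fin h) ℝ × Matrix (Fin h) (Fin n) ℝ,
          lsLoss Xtrn Ytrn W.1 W.2) ≤ ε₂

end BilevelRep

end

/-!
Relaxing the lower-level problem by a gap `δ` lowers the optimal validation loss by at most
`K √δ`. Indeed, by the shared-backbone assumption the relaxed problem has a solution whose training
loss exceeds its global minimum by at most `δ`. A least-squares inverse of the training data
corrects the product `W₁ W₂` to a global minimizer of the training loss, which is in particular
lower-level optimal, and the correction moves the validation residual by `O(√δ)`.

A penalized solution trades this loss of `K √δ` against the penalty `γ δ`. By Young's inequality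
`K √δ - γ δ ≤ K² / (4 γ)`, so global bilevel solutions are `K² / (4 γ)`-optimal for the penalized
problem, and the gap of a penalized `ε`-solution is `O(1 / γ² + ε / γ)`.
-/

namespace BilevelRep

section Real

variable {a b c s : ℝ}

theorem mul_le_mul_sq_add_sq_div (ha : 0 < a) : b * s ≤ a * s ^ 2 + b ^ 2 / (4 * a) := by
  have square_completion :
      a * s ^ 2 + b ^ 2 / (4 * a) - b * s = (2 * a * s - b) ^ 2 / (4 * a) := by
    field_simp
    ring
  have : 0 ≤ (2 * a * s - b) ^ 2 / (4 * a) := by positivity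
  linarith

theorem sq_le_of_mul_sq_le_mul_add (ha : 0 < a) (h : a * s ^ 2 ≤ b * s + c) :
    s ^ 2 ≤ (b / a) ^ 2 + 2 * c / a := by
  have half_absorbed : a * s ^ 2 ≤ b ^ 2 / a + 2 * c := by
    have young := mul_le_mul_sq_add_sq_div (b := b) (s := s) (half_pos ha)
    have : b ^ 2 / (4 * (a / 2)) = b ^ 2 / a / 2 := by
      field_simp
      norm_num
    linarith
  calc s ^ 2 = a * s ^ 2 / a := by field_simp
    _ ≤ (b ^ 2 / a + 2 * c) / a := by gcongr
    _ = (b / a) ^ 2 + 2 * c / a := by field_simp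

theorem le_add_mul_sqrt_of_sqrt_le {t : ℝ} (ha : 0 ≤ a) (hb : 0 ≤ b)
    (h : √a ≤ √b + c * √t) : a ≤ b + 2 * c * √a * √t := by
  have hmul : √a * √a ≤ √a * (√b + c * √t) := mul_le_mul_of_nonneg_left h (Real.sqrt_nonneg a)
  have two_mul_le : 2 * (√a * √b) ≤ a + b := by
    have := two_mul_le_add_sq √a √b
    rw [Real.sq_sqrt ha, Real.sq_sqrt hb] at this
    linarith
  rw [Real.mul_self_sqrt ha] at hmul
  linarith

end Real

section Abstract

variable {U V : Type*} {f g : U → V → ℝ} {u u₀ : U} {v v₀ : V} {K γ ε : ℝ}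

/-- The lower-level optimality gap `g(u,v) - g*(u)`, the quantity that the penalized problem
penalizes and that the relaxed bilevel problem bounds. -/
noncomputable def lowerGap (g : U → V → ℝ) (u : U) (v : V) : ℝ := g u v - valueFn g u

theorem lowerGap_nonneg (hg : BddBelow (Set.range (g u))) : 0 ≤ lowerGap g u v :=
  sub_nonneg.2 (ciInf_le hg v)

theorem lowerGap_eq_zero (hv : v ∈ lowerSolutions g u) : lowerGap g u v = 0 := by
  have : Nonempty V := ⟨v⟩
  have hleast : IsLeast (Set.range (g u)) (g u v) :=
    ⟨Set.mem_range_self v, Set.forall_mem_range.2 hv⟩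
  exact sub_eq_zero.2 hleast.csInf_eq.symm

theorem mem_lowerSolutions_of_lowerGap_nonpos (hg : BddBelow (Set.range (g u)))
    (h : lowerGap g u v ≤ 0) : v ∈ lowerSolutions g u := fun v' =>
  (sub_nonpos.1 h).trans (ciInf_le hg v')

theorem IsApproxBilevelSolution.isGlobalBilevelSolution (hg : BddBelow (Set.range (g u)))
    (h : IsApproxBilevelSolution f g 0 0 u v) : IsGlobalBilevelSolution f g u v :=
  ⟨mem_lowerSolutions_of_lowerGap_nonpos hg h.1, fun u' v' hv' => by
    simpa only [add_zero] using h.2 u' v' (lowerGap_eq_zero hv').le⟩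

theorem IsGlobalBilevelSolution.value_eq (h : IsGlobalBilevelSolution f g u v)
    (h₀ : IsGlobalBilevelSolution f g u₀ v₀) : f u v = f u₀ v₀ :=
  le_antisymm (h.2 _ _ h₀.1) (h₀.2 _ _ h.1)

theorem penalized_eq_of_mem_lowerSolutions (hv : v ∈ lowerSolutions g u) :
    penalized f g γ u v = f u v := by
  change f u v + γ * lowerGap g u v = f u v
  rw [lowerGap_eq_zero hv, mul_zero, add_zero]

/-- Calmness of order `1 / 2` of the bilevel value `a`: relaxing the lower-level problem by a gap
`δ` lowers the upper-level objective to no less than `a - K √δ`. -/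
def IsSqrtCalm (f g : U → V → ℝ) (a K : ℝ) : Prop :=
  ∀ u v, a ≤ f u v + K * √(lowerGap g u v)

theorem IsGlobalBilevelSolution.isSqrtCalm {c : ℝ} (hf : ∀ u v, 0 ≤ f u v)
    (h₀ : IsGlobalBilevelSolution f g u₀ v₀)
    (hcorrect : ∀ u v, ∃ u', ∃ v' ∈ lowerSolutions g u',
      √(f u' v') ≤ √(f u v) + c * √(lowerGap g u v)) :
    IsSqrtCalm f g (f u₀ v₀) (2 * c * √(f u₀ v₀)) := by
  intro u v
  obtain ⟨u', v', hv', hle⟩ := hcorrect u v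
  exact le_add_mul_sqrt_of_sqrt_le (hf u₀ v₀) (hf u v)
    ((Real.sqrt_le_sqrt (h₀.2 u' v' hv')).trans hle)

theorem IsApproxPenalizedSolution.isApproxBilevelSolution (hγ : 0 ≤ γ)
    (h : IsApproxPenalizedSolution f g γ ε u v) :
    IsApproxBilevelSolution f g ε (lowerGap g u v) u v := by
  refine ⟨le_rfl, fun u' v' hgap => ?_⟩
  have hpen : f u v + γ * lowerGap g u v ≤ f u' v' + γ * lowerGap g u' v' + ε := h u' v'
  have : γ * lowerGap g u' v' ≤ γ * lowerGap g u v := mul_le_mul_of_nonneg_left hgap hγ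
  linarith

theorem IsApproxPenalizedSolution.lowerGap_le (hg : BddBelow (Set.range (g u)))
    (hv₀ : v₀ ∈ lowerSolutions g u₀) (hcalm : IsSqrtCalm f g (f u₀ v₀) K) (hγ : 0 < γ)
    (h : IsApproxPenalizedSolution f g γ ε u v) :
    lowerGap g u v ≤ (K / γ) ^ 2 + 2 * ε / γ := by
  have hpen : f u v + γ * lowerGap g u v ≤ f u₀ v₀ + ε := by
    have hle := h u₀ v₀
    rwa [penalized_eq_of_mem_lowerSolutions hv₀] at hle
  have hsq : √(lowerGap g u v) ^ 2 = lowerGap g u v := Real.sq_sqrt (lowerGap_nonneg hg)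
  have hquad : γ * √(lowerGap g u v) ^ 2 ≤ K * √(lowerGap g u v) + ε := by
    rw [hsq]
    linarith [hcalm u v]
  exact hsq ▸ sq_le_of_mul_sq_le_mul_add hγ hquad

theorem IsApproxPenalizedSolution.lowerGap_le_mul_sq {κ : ℝ} (hg : BddBelow (Set.range (g u)))
    (hv₀ : v₀ ∈ lowerSolutions g u₀) (hcalm : IsSqrtCalm f g (f u₀ v₀) K)
    (hκ : 0 < κ) (hε : 0 < ε) (hγ : κ / ε ≤ γ) (h : IsApproxPenalizedSolution f g γ ε u v) :
    lowerGap g u v ≤ ((K / κ) ^ 2 + 2 / κ) * ε ^ 2 := by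
  calc lowerGap g u v
      ≤ (K / γ) ^ 2 + 2 * ε / γ :=
        h.lowerGap_le hg hv₀ hcalm ((div_pos hκ hε).trans_le hγ)
    _ = K ^ 2 / γ ^ 2 + 2 * ε / γ := by rw [div_pow]
    _ ≤ K ^ 2 / (κ / ε) ^ 2 + 2 * ε / (κ / ε) := by gcongr
    _ = ((K / κ) ^ 2 + 2 / κ) * ε ^ 2 := by field_simp

theorem IsSqrtCalm.isApproxPenalizedSolution (hg : ∀ u, BddBelow (Set.range (g u)))
    (hcalm : IsSqrtCalm f g (f u₀ v₀) K) (hv₀ : v₀ ∈ lowerSolutions g u₀) (hγ : 0 < γ)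
    (hε : K ^ 2 / (4 * γ) ≤ ε) : IsApproxPenalizedSolution f g γ ε u₀ v₀ := by
  intro u v
  have young : K * √(lowerGap g u v) ≤ γ * lowerGap g u v + K ^ 2 / (4 * γ) := by
    simpa only [Real.sq_sqrt (lowerGap_nonneg (hg u))] using
      mul_le_mul_sq_add_sq_div (b := K) (s := √(lowerGap g u v)) hγ
  calc penalized f g γ u₀ v₀
      = f u₀ v₀ := penalized_eq_of_mem_lowerSolutions hv₀
    _ ≤ f u v + γ * lowerGap g u v + ε := by linarith [hcalm u v]
    _ = penalized f g γ u v + ε := rfl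

end Abstract

section Matrix

open Matrix

variable {l m n : Type*} [Fintype m] [Fintype n]

theorem submatrix_one_mul_submatrix_one {k R : Type*} [NonAssocSemiring R] [Fintype l]
    [DecidableEq k] [DecidableEq l] (e : k ↪ l) :
    (1 : Matrix l l R).submatrix e id * (1 : Matrix l l R).submatrix id e = 1 := by
  rw [← submatrix_mul _ _ _ _ _ Function.bijective_id, Matrix.mul_one, submatrix_one_embedding]

theorem exists_mul_eq_of_min_card_le {R : Type*} [Semiring R] [Fintype l]
    (h : min (Fintype.card m) (Fintype.card n) ≤ Fintype.card l) (M : Matrix m n R) :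
    ∃ (A : Matrix m l R) (B : Matrix l n R), A * B = M := by
  classical
  rcases min_le_iff.1 h with hm | hn
  · obtain ⟨e⟩ := Function.Embedding.nonempty_of_card_le hm
    refine ⟨(1 : Matrix l l R).submatrix e id, (1 : Matrix l l R).submatrix id e * M, ?_⟩
    rw [← Matrix.mul_assoc, submatrix_one_mul_submatrix_one, Matrix.one_mul]
  · obtain ⟨e⟩ := Function.Embedding.nonempty_of_card_le hn
    refine ⟨M * (1 : Matrix l l R).submatrix e id, (1 : Matrix l l R).submatrix id e, ?_⟩
    rw [Matrix.mul_assoc, submatrix_one_mul_submatrix_one, Matrix.mul_one]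

/-- `B` is a least-squares generalized inverse of `X`: for every `Y`, the matrix `B * Y` solves the
normal equations `Xᴴ * X * A = Xᴴ * Y`. -/
def IsLeastSquaresInverse {R : Type*} [Semiring R] [StarRing R] (X : Matrix m n R)
    (B : Matrix n m R) : Prop :=
  Xᴴ * X * B = Xᴴ

section Field

variable {R : Type*} [Field R] [PartialOrder R] [StarRing R] [StarOrderedRing R]

theorem range_mulVecLin_conjTranspose_mul_self (X : Matrix m n R) :
    LinearMap.range (Xᴴ * X).mulVecLin = LinearMap.range Xᴴ.mulVecLin := by
  refine Submodule.eq_of_le_of_finrank_eq ?_ ?_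
  · rw [mulVecLin_mul]
    exact LinearMap.range_comp_le_range _ _
  · change (Xᴴ * X).rank = Xᴴ.rank
    rw [rank_conjTranspose_mul_self, rank_conjTranspose]

theorem exists_isLeastSquaresInverse (X : Matrix m n R) :
    ∃ B : Matrix n m R, IsLeastSquaresInverse X B := by
  classical
  have hcol (i : m) : ∃ b : n → R, (Xᴴ * X) *ᵥ b = Xᴴ *ᵥ Pi.single i 1 := by
    have hmem : Xᴴ *ᵥ Pi.single i 1 ∈ LinearMap.range (Xᴴ * X).mulVecLin := by
      rw [range_mulVecLin_conjTranspose_mul_self]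
      exact ⟨Pi.single i 1, rfl⟩
    exact hmem
  choose b hb using hcol
  refine ⟨(of b)ᵀ, ext_col fun i => ?_⟩
  rw [← mulVec_single_one Xᴴ i, ← hb i]
  rfl

theorem IsLeastSquaresInverse.mul_mul_cancel {X : Matrix m n R} {B : Matrix n m R}
    (hB : IsLeastSquaresInverse X B) : X * B * X = X := by
  classical
  have : Xᴴ * X * (B * X - 1) = 0 := by
    rw [Matrix.mul_sub, ← Matrix.mul_assoc, hB, Matrix.mul_one, sub_self]
  rw [conjTranspose_mul_self_mul_eq_zero, Matrix.mul_sub, Matrix.mul_one, sub_eq_zero] at this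
  rw [Matrix.mul_assoc, this]

end Field

end Matrix

section Frobenius

open Matrix

attribute [local instance] Matrix.frobeniusNormedAddCommGroup

variable {𝕜 m n : Type*} [RCLike 𝕜] [Fintype m] [Fintype n]

theorem frobenius_norm_sq_eq_re_trace (A : Matrix m n 𝕜) : ‖A‖ ^ 2 = RCLike.re (Aᴴ * A).trace := by
  rw [frobenius_norm_def, ← Real.sqrt_eq_rpow, Real.sq_sqrt (by positivity), Finset.sum_comm]
  simp [trace, mul_apply, RCLike.conj_mul]

theorem frobenius_norm_add_sq_of_trace_eq_zero {A B : Matrix m n 𝕜} (h : (Aᴴ * B).trace = 0) :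
    ‖A + B‖ ^ 2 = ‖A‖ ^ 2 + ‖B‖ ^ 2 := by
  have h' : (Bᴴ * A).trace = 0 := by
    rw [← conjTranspose_conjTranspose A, ← conjTranspose_mul, trace_conjTranspose, h, star_zero]
  simp only [frobenius_norm_sq_eq_re_trace, conjTranspose_add, Matrix.add_mul, Matrix.mul_add,
    trace_add, map_add, h, h', add_zero, zero_add]

end Frobenius

section Loss

open Matrix

attribute [local instance] Matrix.frobeniusNormedAddCommGroup

variable {N N' m n h : ℕ}

theorem lsLoss_nonneg (X : Matrix (Fin N) (Fin m) ℝ) (Y : Matrix (Fin N) (Fin n) ℝ)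
    (W₁ : Matrix (Fin m) (Fin h) ℝ) (W₂ : Matrix (Fin h) (Fin n) ℝ) : 0 ≤ lsLoss X Y W₁ W₂ := by
  unfold lsLoss
  positivity

theorem bddBelow_range_lsLoss (X : Matrix (Fin N) (Fin m) ℝ) (Y : Matrix (Fin N) (Fin n) ℝ)
    (W₁ : Matrix (Fin m) (Fin h) ℝ) : BddBelow (Set.range (lsLoss X Y W₁)) :=
  ⟨0, Set.forall_mem_range.2 (lsLoss_nonneg X Y W₁)⟩

theorem sqrt_lsLoss (X : Matrix (Fin N) (Fin m) ℝ) (Y : Matrix (Fin N) (Fin n) ℝ)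
    (W₁ : Matrix (Fin m) (Fin h) ℝ) (W₂ : Matrix (Fin h) (Fin n) ℝ) :
    √(lsLoss X Y W₁ W₂) = √(1 / 2) * ‖Y - X * W₁ * W₂‖ := by
  rw [lsLoss, Real.sqrt_mul one_half_pos.le, Real.sqrt_sq (norm_nonneg _)]

theorem IsLeastSquaresInverse.lsLoss_eq_add {X : Matrix (Fin N) (Fin m) ℝ}
    {B : Matrix (Fin m) (Fin N) ℝ} (hB : IsLeastSquaresInverse X B)
    (Y : Matrix (Fin N) (Fin n) ℝ)
    (W₁ : Matrix (Fin m) (Fin h) ℝ) (W₂ : Matrix (Fin h) (Fin n) ℝ) :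
    lsLoss X Y W₁ W₂ = 1 / 2 * ‖Y - X * (B * Y)‖ ^ 2 + lsLoss X (X * (B * Y)) W₁ W₂ := by
  have normal_equations : (Y - X * (B * Y))ᴴ * X = 0 := by
    rw [← conjTranspose_conjTranspose X, ← conjTranspose_mul, conjTranspose_conjTranspose,
      Matrix.mul_sub, ← Matrix.mul_assoc, ← Matrix.mul_assoc, hB, sub_self, conjTranspose_zero]
  have orthogonal :
      ((Y - X * (B * Y))ᴴ * (X * (B * Y) - X * W₁ * W₂)).trace = 0 := by
    rw [Matrix.mul_assoc X W₁, ← Matrix.mul_sub, ← Matrix.mul_assoc, normal_equations,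
      Matrix.zero_mul, trace_zero]
  have pythagoras := frobenius_norm_add_sq_of_trace_eq_zero orthogonal
  rw [sub_add_sub_cancel] at pythagoras
  rw [lsLoss, lsLoss, pythagoras, mul_add]

theorem exists_lsLoss_eq_zero_sqrt_lsLoss_le (hh : min m n ≤ h) {X : Matrix (Fin N) (Fin m) ℝ}
    {B : Matrix (Fin m) (Fin N) ℝ} (hB : X * B * X = X) (A : Matrix (Fin m) (Fin n) ℝ)
    (X' : Matrix (Fin N') (Fin m) ℝ) (Y' : Matrix (Fin N') (Fin n) ℝ)
    (W₁ : Matrix (Fin m) (Fin h) ℝ) (W₂ : Matrix (Fin h) (Fin n) ℝ) :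
    ∃ (V₁ : Matrix (Fin m) (Fin h) ℝ) (V₂ : Matrix (Fin h) (Fin n) ℝ),
      lsLoss X (X * A) V₁ V₂ = 0 ∧
      √(lsLoss X' Y' V₁ V₂) ≤
        √(lsLoss X' Y' W₁ W₂) + ‖X' * B‖ * √(lsLoss X (X * A) W₁ W₂) := by
  set R := X * A - X * W₁ * W₂ with hR
  obtain ⟨V₁, V₂, hV⟩ := exists_mul_eq_of_min_card_le (l := Fin h)
    (by simpa only [Fintype.card_fin] using hh) (W₁ * W₂ + B * R)
  have interpolates : X * A - X * V₁ * V₂ = 0 := by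
    have hXBR : X * (B * R) = R := by
      rw [hR, Matrix.mul_assoc X W₁, ← Matrix.mul_sub, ← Matrix.mul_assoc, ← Matrix.mul_assoc, hB]
    rw [Matrix.mul_assoc, hV, Matrix.mul_add, hXBR, hR, Matrix.mul_assoc, add_sub_cancel, sub_self]
  have residual_eq : Y' - X' * V₁ * V₂ = (Y' - X' * W₁ * W₂) - X' * B * R := by
    simp only [Matrix.mul_assoc, hV, Matrix.mul_add, sub_sub]
  refine ⟨V₁, V₂, by simp [lsLoss, interpolates], ?_⟩
  calc √(lsLoss X' Y' V₁ V₂)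
      = √(1 / 2) * ‖(Y' - X' * W₁ * W₂) - X' * B * R‖ := by rw [sqrt_lsLoss, residual_eq]
    _ ≤ √(1 / 2) * (‖Y' - X' * W₁ * W₂‖ + ‖X' * B‖ * ‖R‖) := by
        gcongr
        exact (norm_sub_le _ _).trans (by gcongr; exact frobenius_norm_mul _ _)
    _ = √(lsLoss X' Y' W₁ W₂) + ‖X' * B‖ * √(lsLoss X (X * A) W₁ W₂) := by
        rw [sqrt_lsLoss, sqrt_lsLoss]
        ring

theorem exists_minimizer_sqrt_lsLoss_le (hh : min m n ≤ h)
    (X : Matrix (Fin N) (Fin m) ℝ) (Y : Matrix (Fin N) (Fin n) ℝ)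
    (X' : Matrix (Fin N') (Fin m) ℝ) (Y' : Matrix (Fin N') (Fin n) ℝ) :
    ∃ c : ℝ, 0 ≤ c ∧ ∀ (W₁ : Matrix (Fin m) (Fin h) ℝ) (W₂ : Matrix (Fin h) (Fin n) ℝ),
      ∃ (V₁ : Matrix (Fin m) (Fin h) ℝ) (V₂ : Matrix (Fin h) (Fin n) ℝ),
        (∀ (U₁ : Matrix (Fin m) (Fin h) ℝ) (U₂ : Matrix (Fin h) (Fin n) ℝ),
          lsLoss X Y V₁ V₂ ≤ lsLoss X Y U₁ U₂) ∧
        √(lsLoss X' Y' V₁ V₂) ≤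
          √(lsLoss X' Y' W₁ W₂) + c * √(lsLoss X Y W₁ W₂ - lsLoss X Y V₁ V₂) := by
  obtain ⟨B, hB⟩ := exists_isLeastSquaresInverse X
  refine ⟨‖X' * B‖, norm_nonneg _, fun W₁ W₂ => ?_⟩
  obtain ⟨V₁, V₂, hV, hle⟩ :=
    exists_lsLoss_eq_zero_sqrt_lsLoss_le hh hB.mul_mul_cancel (B * Y) X' Y' W₁ W₂
  refine ⟨V₁, V₂, fun U₁ U₂ => ?_, ?_⟩
  · rw [hB.lsLoss_eq_add Y V₁, hB.lsLoss_eq_add Y U₁, hV]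
    gcongr
    exact lsLoss_nonneg _ _ _ _
  · rwa [hB.lsLoss_eq_add Y V₁, hB.lsLoss_eq_add Y W₁, hV, add_zero, add_sub_cancel_left]

theorem SharedBackbone.exists_isSqrtCalm (hh : min m n ≤ h)
    {Xtrn : Matrix (Fin N) (Fin m) ℝ} {Ytrn : Matrix (Fin N) (Fin n) ℝ}
    {Xval : Matrix (Fin N') (Fin m) ℝ} {Yval : Matrix (Fin N') (Fin n) ℝ}
    (hA : SharedBackbone h Xtrn Ytrn Xval Yval)
    {U₁ : Matrix (Fin m) (Fin h) ℝ} {U₂ : Matrix (Fin h) (Fin n) ℝ}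
    (hU : IsGlobalBilevelSolution (lsLoss Xval Yval) (lsLoss Xtrn Ytrn) U₁ U₂) :
    ∃ K : ℝ, IsSqrtCalm (lsLoss (h := h) Xval Yval) (lsLoss Xtrn Ytrn)
      (lsLoss Xval Yval U₁ U₂) K := by
  obtain ⟨c, hc, hcorrect⟩ := exists_minimizer_sqrt_lsLoss_le hh Xtrn Ytrn Xval Yval
  refine ⟨_, hU.isSqrtCalm (c := c) (lsLoss_nonneg Xval Yval) fun W₁ W₂ => ?_⟩
  obtain ⟨Z₁, Z₂, hZ, hZtrn⟩ := hA 0 (lowerGap (lsLoss Xtrn Ytrn) W₁ W₂) le_rfl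
    (lowerGap_nonneg (bddBelow_range_lsLoss Xtrn Ytrn W₁))
  have hZval : lsLoss Xval Yval Z₁ Z₂ ≤ lsLoss Xval Yval W₁ W₂ := by
    simpa only [add_zero] using hZ.2 W₁ W₂ le_rfl
  obtain ⟨V₁, V₂, hVmin, hVval⟩ := hcorrect Z₁ Z₂
  have hZexcess : lsLoss Xtrn Ytrn Z₁ Z₂ - lsLoss Xtrn Ytrn V₁ V₂ ≤
      lowerGap (lsLoss Xtrn Ytrn) W₁ W₂ := by
    refine (sub_le_sub_left ?_ _).trans hZtrn
    exact ciInf_le (f := fun W : Matrix (Fin m) (Fin h) ℝ × Matrix (Fin h) (Fin n) ℝ =>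
      lsLoss Xtrn Ytrn W.1 W.2) ⟨0, Set.forall_mem_range.2 fun _ => lsLoss_nonneg _ _ _ _⟩ (V₁, V₂)
  refine ⟨V₁, V₂, hVmin V₁, hVval.trans ?_⟩
  gcongr

end Loss

end BilevelRep

theorem mainTheorem6_general {N N' m n h : ℕ}
    (Xtrn : Matrix (Fin N) (Fin m) ℝ) (Ytrn : Matrix (Fin N) (Fin n) ℝ)
    (Xval : Matrix (Fin N') (Fin m) ℝ) (Yval : Matrix (Fin N') (Fin n) ℝ)
    (hh : min m n ≤ h)
    (hA : BilevelRep.SharedBackbone h Xtrn Ytrn Xval Yval) :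
    (∀ κ : ℝ, 0 < κ → ∃ C : ℝ, 0 < C ∧ ∀ ε₂ : ℝ, 0 < ε₂ → ∀ γ : ℝ, κ / ε₂ ≤ γ →
      ∀ (W₁ : Matrix (Fin m) (Fin h) ℝ) (W₂ : Matrix (Fin h) (Fin n) ℝ),
        BilevelRep.IsApproxPenalizedSolution
          (BilevelRep.lsLoss Xval Yval) (BilevelRep.lsLoss Xtrn Ytrn) γ ε₂ W₁ W₂ →
        ∃ εγ : ℝ, 0 ≤ εγ ∧ εγ ≤ C * ε₂ ^ 2 ∧
          BilevelRep.IsApproxBilevelSolution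
            (BilevelRep.lsLoss Xval Yval) (BilevelRep.lsLoss Xtrn Ytrn) ε₂ εγ W₁ W₂) ∧
    (∃ C : ℝ, 0 < C ∧ ∀ ε₁ : ℝ, 0 < ε₁ → ∃ γstar : ℝ, 0 < γstar ∧ γstar ≤ C * ε₁⁻¹ ∧
      ∀ γ : ℝ, γstar < γ →
        ∀ (W₁ : Matrix (Fin m) (Fin h) ℝ) (W₂ : Matrix (Fin h) (Fin n) ℝ),
          BilevelRep.IsGlobalBilevelSolution
            (BilevelRep.lsLoss Xval Yval) (BilevelRep.lsLoss Xtrn Ytrn) W₁ W₂ →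
          BilevelRep.IsApproxPenalizedSolution
            (BilevelRep.lsLoss Xval Yval) (BilevelRep.lsLoss Xtrn Ytrn) γ ε₁ W₁ W₂) := by
  have hbdd := BilevelRep.bddBelow_range_lsLoss (h := h) Xtrn Ytrn
  obtain ⟨U₁, U₂, hU₀, -⟩ := hA 0 0 le_rfl le_rfl
  have hU := hU₀.isGlobalBilevelSolution (hbdd U₁)
  obtain ⟨K, hK⟩ := hA.exists_isSqrtCalm hh hU
  constructor
  · intro κ hκ
    refine ⟨(K / κ) ^ 2 + 2 / κ, by positivity, fun ε₂ hε₂ γ hγ W₁ W₂ hW => ?_⟩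
    exact ⟨BilevelRep.lowerGap _ W₁ W₂, BilevelRep.lowerGap_nonneg (hbdd W₁),
      hW.lowerGap_le_mul_sq (hbdd W₁) hU.1 hK hκ hε₂ hγ,
      hW.isApproxBilevelSolution ((div_pos hκ hε₂).le.trans hγ)⟩
  · refine ⟨K ^ 2 / 4 + 1, by positivity, fun ε₁ hε₁ =>
      ⟨(K ^ 2 / 4 + 1) * ε₁⁻¹, by positivity, le_rfl, fun γ hγ W₁ W₂ hW => ?_⟩⟩
    have hγpos : 0 < γ := lt_trans (by positivity) hγ
    have hε₁_large : K ^ 2 / (4 * γ) ≤ ε₁ := by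
      rw [← div_eq_mul_inv, div_lt_iff₀ hε₁] at hγ
      rw [div_le_iff₀ (by positivity)]
      linarith
    rw [← hW.value_eq hU] at hK
    exact hK.isApproxPenalizedSolution hbdd hW.1 hγpos hε₁_large

theorem mainTheorem6 {N N' m n h : ℕ}
    (Xtrn : Matrix (Fin N) (Fin m) ℝ) (Ytrn : Matrix (Fin N) (Fin n) ℝ)
    (Xval : Matrix (Fin N') (Fin m) ℝ) (Yval : Matrix (Fin N') (Fin n) ℝ)
    (hm : max N N' ≤ m) (hh : max m n ≤ h)
    (hXtrn : Xtrn.rank = N) (hXval : Xval.rank = N')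
    (hA : BilevelRep.SharedBackbone h Xtrn Ytrn Xval Yval) :
    (∀ κ : ℝ, 0 < κ → ∃ C : ℝ, 0 < C ∧ ∀ ε₂ : ℝ, 0 < ε₂ → ∀ γ : ℝ, κ / ε₂ ≤ γ →
      ∀ (W₁ : Matrix (Fin m) (Fin h) ℝ) (W₂ : Matrix (Fin h) (Fin n) ℝ),
        BilevelRep.IsApproxPenalizedSolution
          (BilevelRep.lsLoss Xval Yval) (BilevelRep.lsLoss Xtrn Ytrn) γ ε₂ W₁ W₂ →
        ∃ εγ : ℝ, 0 ≤ εγ ∧ εγ ≤ C * ε₂ ^ 2 ∧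
          BilevelRep.IsApproxBilevelSolution
            (BilevelRep.lsLoss Xval Yval) (BilevelRep.lsLoss Xtrn Ytrn) ε₂ εγ W₁ W₂) ∧
    (∃ C : ℝ, 0 < C ∧ ∀ ε₁ : ℝ, 0 < ε₁ → ∃ γstar : ℝ, 0 < γstar ∧ γstar ≤ C * ε₁⁻¹ ∧
      ∀ γ : ℝ, γstar < γ →
        ∀ (W₁ : Matrix (Fin m) (Fin h) ℝ) (W₂ : Matrix (Fin h) (Fin n) ℝ),
          BilevelRep.IsGlobalBilevelSolution
            (BilevelRep.lsLoss Xval Yval) (BilevelRep.lsLoss Xtrn Ytrn) W₁ W₂ →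
          BilevelRep.IsApproxPenalizedSolution
            (BilevelRep.lsLoss Xval Yval) (BilevelRep.lsLoss Xtrn Ytrn) γ ε₁ W₁ W₂) :=
  mainTheorem6_general Xtrn Ytrn Xval Yval
    ((min_le_left m n).trans ((le_max_left m n).trans hh)) hA
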